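/- Let $\kappa$ be a weakly compact cardinal (that is, $\kappa>\aleph_0$ and $\kappa\to(\kappa)^2_2$), let $n\ge 1$ be an integer, and let $A$ be an abelian group such that $|A|<\kappa$ or $n=1$. For an ordinal $\delta$ and $m\ge 0$ let $[\delta]^m$ be the set of increasing $m$-tuples $\vec\alpha=(\alpha_0<\dots<\alpha_{m-1})$ of elements of $\delta$, and let $\vec\alpha^i$ be $\vec\alpha$ with its $i$-th coordinate deleted; $f=^*g$ means that $f$ and $g$ differ at only finitely many points of their common domain. For $m\ge 1$, a family $\Phi=\{\varphi_{\vec\alpha}:\alpha_0\to A\mid\vec\alpha\in[\delta]^m\}$ is *$m$-coherent* if $$\sum_{i=0}^{m}(-1)^i\,\varphi_{\vec\alpha^i}\!\restriction\!\alpha_0=^*0\qquad\text{for all }\vec\alpha\in[\delta]^{m+1}.$$ It is *$m$-trivial* if either $m=1$ and there is a function $\psi:\delta\to A$ with $\psi\!\restriction\!\beta=^*\varphi_\beta$ for all $\beta<\delta$, or $m>1$ and there is a family $\{\psi_{\vec\alpha}:\alpha_0\to A\mid\vec\alpha\in[\delta]^{m-1}\}$ with $$\sum_{i=0}^{m-1}(-1)^i\,\psi_{\vec\alpha^i}\!\restriction\!\alpha_0=^*\varphi_{\vec\alpha}\qquad\text{for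 all }\vec\alpha\in[\delta]^m.$$ Then every $n$-coherent family $\{\varphi_{\vec\alpha}:\alpha_0\to A\mid\vec\alpha\in[\kappa]^n\}$ is $n$-trivial. Moreover $\check{\mathrm H}^n(\kappa,\mathcal A_d)=0$, where $\kappa$ carries the order topology, $\mathcal A_d$ is the sheaf $U\mapsto\{f:U\to A\mid f\text{ locally constant}\}$, and $\check{\mathrm H}^n(\kappa,\mathcal A_d)$ is the Čech cohomology group, i.e. the direct limit, over the open covers $\mathcal V$ of $\kappa$ ordered by refinement, of the groups $\mathrm H^n(\mathcal V,\mathcal A_d)$. -/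

import Mathlib

open Cardinal TopologicalSpace

universe u v w

/-! ### Weakly compact cardinals -/

/-- A cardinal `κ` is weakly compact if it is uncountable and satisfies the partition relation
`κ → (κ)²₂`: every 2-colouring of the pairs from a set of size `κ` has a homogeneous set of
size `κ`. (The values of `f` on the diagonal of `Sym2 S` play no role.) -/
def IsWeaklyCompact (κ : Cardinal.{u}) : Prop :=
  ℵ₀ < κ ∧ ∀ (S : Type u), #S = κ → ∀ f : Sym2 S → Bool,
    ∃ H : Set S, #H = κ ∧ ∃ b : Bool, ∀ x ∈ H, ∀ y ∈ H, x ≠ y → f s(x, y) = b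

/-! ### Higher-dimensional coherence and triviality -/

namespace OrdinalFamily

/-- The set `[δ]ⁿ` of `n`-element subsets of the ordinal `δ`, identified with their increasing
enumerations `(α₀, …, αₙ₋₁)`. -/
abbrev Tuple (δ : Ordinal.{u}) (n : ℕ) : Type (u + 1) := Fin n ↪o Set.Iio δ

variable {δ : Ordinal.{u}} {n : ℕ}

/-- The tuple `αʲ`, obtained from `α` by deleting the `j`-th coordinate. -/
def Tuple.face (α : Tuple δ (n + 1)) (j : Fin (n + 1)) : Tuple δ n :=
  (Fin.succAboveOrderEmb j).trans α

/-- The common domain `α₀ ∩ ⋯ ∩ αₙ₋₁` of the functions indexed by `α ∈ [δ]ⁿ`. It is `α₀` for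
positive `n` (see `Tuple.dom_succ`), and all of `δ` for the empty tuple. -/
def Tuple.dom (α : Tuple δ n) : Set (Set.Iio δ) := {ξ | ∀ i, ξ < α i}

theorem Tuple.dom_succ (α : Tuple δ (n + 1)) : α.dom = Set.Iio (α 0) := by
  ext ξ
  exact ⟨fun h => h 0, fun h i => lt_of_lt_of_le h (α.monotone (Fin.zero_le i))⟩

theorem Tuple.dom_zero (α : Tuple δ 0) : α.dom = Set.univ := by
  ext ξ
  exact ⟨fun _ => trivial, fun _ i => i.elim0⟩

theorem Tuple.dom_subset_face (α : Tuple δ (n + 1)) (j : Fin (n + 1)) :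
    α.dom ⊆ (α.face j).dom := fun _ h i => h (j.succAbove i)

end OrdinalFamily

open OrdinalFamily in
/-- An `A`-valued family `Φ = {φ_α : α₀ → A | α ∈ [δ]ⁿ}` of height `δ` (for `n = 0`, a single
function `δ → A`). -/
abbrev OrdinalFamily (δ : Ordinal.{u}) (n : ℕ) (A : Type v) : Type (max (u + 1) v) :=
  (α : Tuple δ n) → α.dom → A

namespace OrdinalFamily

variable {δ : Ordinal.{u}} {n : ℕ} {A : Type v} [AddCommGroup A]

/-- The function `∑ᵢ (-1)ⁱ φ_{αⁱ}`, with every summand restricted to the domain of `α`. -/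
def alternatingSum (Φ : OrdinalFamily δ n A) (α : Tuple δ (n + 1)) (ξ : α.dom) : A :=
  ∑ i : Fin (n + 1), (-1 : ℤ) ^ (i : ℕ) • Φ (α.face i) ⟨ξ, α.dom_subset_face i ξ.2⟩

/-- `Φ` is `n`-coherent: `∑ᵢ (-1)ⁱ φ_{αⁱ}` has finite support for every `α ∈ [δ]ⁿ⁺¹`. -/
def IsCoherent (Φ : OrdinalFamily δ n A) : Prop :=
  ∀ α : Tuple δ (n + 1), {ξ : α.dom | Φ.alternatingSum α ξ ≠ 0}.Finite

/-- `Φ` is `n`-trivial. In positive dimension there is a family `Ψ` of dimension one less such that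
`∑ᵢ (-1)ⁱ ψ_{αⁱ}` and `φ_α` differ at only finitely many places for every `α`. In dimension one
`Ψ` amounts to a single function `ψ : δ → A`, and the condition says that `ψ ↾ β =* φ_β` for all
`β < δ`. In dimension zero, the single function that `Φ` consists of has finite support. -/
def IsTrivial : {n : ℕ} → OrdinalFamily δ n A → Prop
  | 0, Φ => ∀ α : Tuple δ 0, {ξ : α.dom | Φ α ξ ≠ 0}.Finite
  | n + 1, Φ => ∃ Ψ : OrdinalFamily δ n A,
      ∀ α : Tuple δ (n + 1), {ξ : α.dom | Ψ.alternatingSum α ξ ≠ Φ α ξ}.Finite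

end OrdinalFamily

/-! ### Čech cohomology with coefficients in the sheaf of locally constant functions -/

namespace Cech

variable {X : Type u} [TopologicalSpace X]

/-- The intersection `U (s 0) ∩ ⋯ ∩ U (s (n - 1))` of members of a family of open sets. -/
def inter {ι : Type w} (U : ι → Opens X) {n : ℕ} (s : Fin n → ι) : Set X := {x | ∀ i, x ∈ U (s i)}

variable (A : Type v) [AddCommGroup A]

/-- The restriction maps of the sheaf of locally constant functions to `A`. -/
def res {S T : Set X} (h : S ⊆ T) : LocallyConstant T A →+ LocallyConstant S A where
  toFun f := f.comap ⟨Set.inclusion h, continuous_inclusion h⟩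
  map_zero' := rfl
  map_add' _ _ := rfl

variable {ι : Type w} (U : ι → Opens X)

/-- The group of `n`-cochains: all families of sections of the sheaf of locally constant
functions to `A` over the intersections of `n + 1` members of `U`. -/
abbrev Cochain (n : ℕ) : Type (max u v w) :=
  (s : Fin (n + 1) → ι) → LocallyConstant (inter U s) A

/-- The coboundary map `(d f)(s) = ∑ᵢ (-1)ⁱ f(sⁱ)`, where `sⁱ` omits the `i`-th entry of `s`. -/
def d (n : ℕ) : Cochain A U n →+ Cochain A U (n + 1) where
  toFun f s := ∑ i : Fin (n + 2), (-1 : ℤ) ^ (i : ℕ) •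
    res A (fun _ hx j => hx (i.succAbove j) : inter U s ⊆ inter U (s ∘ i.succAbove))
      (f (s ∘ i.succAbove))
  map_zero' := funext fun s => Finset.sum_eq_zero fun i _ => by
    rw [Pi.zero_apply]
    exact (congrArg _ (map_zero (res A _))).trans (smul_zero _)
  map_add' f g := funext fun s => by
    rw [Pi.add_apply, ← Finset.sum_add_distrib]
    refine Finset.sum_congr rfl fun i _ => ?_
    rw [Pi.add_apply, ← smul_add]
    exact congrArg _ (map_add (res A _) _ _)

/-- The group of `n`-cocycles. -/
def cocycles (n : ℕ) : AddSubgroup (Cochain A U n) := (d A U n).ker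

/-- The group of `n`-coboundaries. -/
def coboundaries : (n : ℕ) → AddSubgroup (Cochain A U n)
  | 0 => ⊥
  | n + 1 => (d A U n).range

/-- The cohomology group `Hⁿ(U, A_d)` of the family `U`: cocycles modulo coboundaries. -/
abbrev CoverCohomology (n : ℕ) : Type (max u v w) :=
  cocycles A U n ⧸ (coboundaries A U n).addSubgroupOf (cocycles A U n)

variable {κ : Type w} {U} {W : κ → Opens X}

/-- The map on cochains induced by a refining map `r`. -/
def pullback (r : κ → ι) (hr : ∀ k, W k ≤ U (r k)) (n : ℕ) : Cochain A U n →+ Cochain A W n where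
  toFun f s := res A (fun _ hx i => hr (s i) (hx i) : inter W s ⊆ inter U (r ∘ s)) (f (r ∘ s))
  map_zero' := rfl
  map_add' _ _ := rfl

theorem d_pullback (r : κ → ι) (hr : ∀ k, W k ≤ U (r k)) (n : ℕ) (f : Cochain A U n) :
    d A W n (pullback A r hr n f) = pullback A r hr (n + 1) (d A U n f) := by
  funext s
  change _ = res A _ (∑ i, _)
  rw [map_sum]
  simp only [map_zsmul]
  rfl

theorem pullback_mem_cocycles (r : κ → ι) (hr : ∀ k, W k ≤ U (r k)) (n : ℕ)
    {f : Cochain A U n} (hf : f ∈ cocycles A U n) : pullback A r hr n f ∈ cocycles A W n := by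
  have h : d A U n f = 0 := hf
  change d A W n _ = 0
  rw [d_pullback, h, map_zero]

theorem pullback_mem_coboundaries (r : κ → ι) (hr : ∀ k, W k ≤ U (r k)) (n : ℕ)
    {f : Cochain A U n} (hf : f ∈ coboundaries A U n) :
    pullback A r hr n f ∈ coboundaries A W n := by
  cases n with
  | zero =>
    obtain rfl : f = 0 := hf
    exact (coboundaries A W 0).zero_mem
  | succ n =>
    obtain ⟨g, rfl⟩ := hf
    exact ⟨pullback A r hr n g, d_pullback A r hr n g⟩

/-- The map on cocycles induced by a refining map `r`. -/
def cocyclesMap (r : κ → ι) (hr : ∀ k, W k ≤ U (r k)) (n : ℕ) :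
    cocycles A U n →+ cocycles A W n :=
  ((pullback A r hr n).comp (cocycles A U n).subtype).codRestrict _
    fun f => pullback_mem_cocycles A r hr n f.2

/-- The map `r* : Hⁿ(U, A_d) → Hⁿ(W, A_d)` induced by a refining map `r`. -/
def coverCohomologyMap (r : κ → ι) (hr : ∀ k, W k ≤ U (r k)) (n : ℕ) :
    CoverCohomology A U n →+ CoverCohomology A W n :=
  QuotientAddGroup.map _ _ (cocyclesMap A r hr n)
    fun _ hf => pullback_mem_coboundaries A r hr n hf

variable (X) in
/-- `Cov(X)`: the open covers of `X`, each a set of open subsets with union `X`. -/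
structure OpenCover where
  sets : Set (Opens X)
  sSup_eq : sSup sets = ⊤

/-- `V ≤ W` means that `W` refines `V`. -/
instance : Preorder (OpenCover X) where
  le V W := ∀ w ∈ W.sets, ∃ v ∈ V.sets, w ≤ v
  le_refl V w hw := ⟨w, hw, le_rfl⟩
  le_trans U V W h₁ h₂ w hw := by
    obtain ⟨v, hv, hwv⟩ := h₂ w hw
    obtain ⟨u, hu, hvu⟩ := h₁ v hv
    exact ⟨u, hu, hwv.trans hvu⟩

/-- A cover, as a family of open sets indexed by its members. -/
def OpenCover.family (V : OpenCover X) : V.sets → Opens X := Subtype.val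

/-- A refining map for a refinement `W` of `V`. (The map that it induces in cohomology does not
depend on the choice.) -/
noncomputable def OpenCover.refine {V W : OpenCover X} (h : V ≤ W) (w : W.sets) : V.sets :=
  ⟨(h w.1 w.2).choose, (h w.1 w.2).choose_spec.1⟩

theorem OpenCover.le_refine {V W : OpenCover X} (h : V ≤ W) (w : W.sets) :
    W.family w ≤ V.family (OpenCover.refine h w) :=
  (h w.1 w.2).choose_spec.2

variable (X) in
open Classical in
/-- The Čech cohomology group `Ȟⁿ(X, A_d)` of `X` with coefficients in the sheaf of locally
constant functions to `A`: the direct limit, over the open covers of `X` ordered by refinement,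
of the cohomology groups of the covers. -/
abbrev Cohomology (n : ℕ) : Type (max u v) :=
  AddCommGroup.DirectLimit (fun V : OpenCover X => CoverCohomology A V.family n)
    (fun _ _ h => coverCohomologyMap A (OpenCover.refine h) (OpenCover.le_refine h) n)

end Cech

/-! Suppose first that `κ` carried a uniform `κ`-complete ultrafilter. Integrating out a last
coordinate, `ψ_α(ξ) = ± lim_β φ_{αβ}(ξ)`, would give a primitive: in the coherence sum of `αβ`, the
face deleting `β` is `φ_α` and the other faces tend to the `ψ`'s. Weak compactness supplies enough
of such an ultrafilter: given at most `κ` sets, there is a uniform `κ`-complete filter deciding each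
of them (`exists_filter`). If `|A| < κ`, completeness makes the given functions converge. If `n =
1`, at most two functions occur in each sum, and a non-additive operator compatible with adding
constants replaces the limit (`exists_limit`).

For families, infinitely many errors at one `α` would, by countable completeness, occur at a single
`β`, against coherence (`OrdinalFamily.IsCoherent.isTrivial`). For Čech cocycles the last coordinate
is a cover member `q β x` containing `x`; refinements with at most `κ` members and such a `q` are
cofinal (`OpenCover.exists_refinement`), and completeness keeps the primitive locally constant
(`mem_coboundaries_of_mem_cocycles`). -/

open Filter

/-! ### Weak compactness as a property of an order; regularity -/

/-- A well-ordered set is weakly compact if it is uncountable, its initial segments are smaller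
than the whole set, and it satisfies the partition relation for pairs and two colours. -/
structure IsWeaklyCompactOrder (K : Type w) [LinearOrder K] : Prop where
  uncountable : IsEmpty (K ↪ ℕ)
  small_Iic : ∀ x : K, IsEmpty (K ↪ Set.Iic x)
  homogeneous : ∀ f : Sym2 K → Bool, ∃ H : Set K, Nonempty (K ↪ H) ∧
    ∃ b : Bool, ∀ x ∈ H, ∀ y ∈ H, x ≠ y → f s(x, y) = b

/-- The ordinals below `κ.ord` live one universe above the sets in the partition relation, so
colourings are transferred along a bijection with `κ.out`. -/
theorem IsWeaklyCompact.isWeaklyCompactOrder {κ : Cardinal.{u}} (hκ : IsWeaklyCompact κ) :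
    IsWeaklyCompactOrder (Set.Iio κ.ord) where
  uncountable := by
    rw [← not_nonempty_iff, ← Cardinal.lift_mk_le', Cardinal.mk_Iio_ordinal, Cardinal.card_ord]
    simpa using hκ.1
  small_Iic x := by
    rw [← not_nonempty_iff, ← Cardinal.lift_mk_le']
    simp only [Cardinal.lift_id, not_le]
    have hlim := Cardinal.isSuccLimit_ord hκ.1.le
    have h1 : Order.succ x.1 < κ.ord := hlim.succ_lt x.2
    have h2 : #(Set.Iic x) ≤ #(Set.Iio (Order.succ x.1)) :=
      Cardinal.mk_le_of_injective (f := fun y : Set.Iic x => ⟨y.1.1, Set.mem_Iio.2 (Order.lt_succ_of_le y.2)⟩)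
        fun a b h => by
          simp only [Subtype.mk.injEq] at h
          exact Subtype.ext (Subtype.ext h)
    refine h2.trans_lt ?_
    rw [Cardinal.mk_Iio_ordinal, Cardinal.mk_Iio_ordinal, Cardinal.card_ord, Cardinal.lift_lt]
    exact Cardinal.lt_ord.1 h1
  homogeneous f := by
    obtain ⟨e⟩ : Nonempty (Set.Iio κ.ord ≃ κ.out) := by
      rw [← Cardinal.lift_mk_eq', Cardinal.mk_Iio_ordinal]
      simp
    obtain ⟨H, hH, b, hb⟩ := hκ.2 κ.out κ.mk_out fun p => f (p.map e.symm)
    refine ⟨e ⁻¹' H, ?_, b, fun x hx y hy hxy => ?_⟩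
    · obtain ⟨g⟩ : Nonempty (κ.out ≃ H) := Cardinal.eq.1 (by rw [hH, Cardinal.mk_out])
      exact ⟨((e.trans g).trans (e.subtypeEquiv fun _ => Iff.rfl).symm).toEmbedding⟩
    · simpa using hb (e x) hx (e y) hy (e.injective.ne hxy)

namespace IsWeaklyCompactOrder

variable {K : Type w} [LinearOrder K] (hK : IsWeaklyCompactOrder K)
include hK

theorem exists_lt_of_embedding {H : Set K} (hH : Nonempty (K ↪ H)) (x : K) : ∃ y ∈ H, x < y := by
  by_contra! h
  obtain ⟨e⟩ := hH
  exact (hK.small_Iic x).false (e.trans (Set.embeddingOfSubset _ _ h))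

theorem noMaxOrder : NoMaxOrder K := ⟨fun x => by
  obtain ⟨y, -, h⟩ := hK.exists_lt_of_embedding (H := Set.univ) ⟨(Equiv.Set.univ K).symm.toEmbedding⟩ x
  exact ⟨y, h⟩⟩

theorem infinite : Infinite K := by
  by_contra h
  rw [not_infinite_iff_finite] at h
  obtain ⟨n, ⟨e⟩⟩ := Finite.exists_equiv_fin K
  exact hK.uncountable.false (e.toEmbedding.trans Fin.valEmbedding)

theorem nonempty : Nonempty K := hK.infinite.nonempty

theorem aleph0_le : ℵ₀ ≤ #K := Cardinal.infinite_iff.1 hK.infinite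

/-- Regularity: maps from smaller sets are bounded. -/
theorem bounded {T : Type*} (hT : IsEmpty (K ↪ T)) (g : T → K) : ∃ b, ∀ t, g t ≤ b := by
  classical
  by_contra! h
  choose t ht using h
  -- Colour a pair by whether `t` identifies its points. On a homogeneous set `t` is injective,
  -- which embeds `K` in `T`, or constant, and then one value of `g` bounds an unbounded set.
  obtain ⟨H, hH, b, hb⟩ := hK.homogeneous fun p => decide (p.map t).IsDiag
  cases b with
  | false =>
    obtain ⟨e⟩ := hH
    refine hT.false (e.trans ⟨fun x : H => t x, fun x y hxy => ?_⟩)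
    by_contra hne
    have := hb x x.2 y y.2 (fun h => hne (Subtype.ext h))
    simp [hxy] at this
  | true =>
    obtain ⟨x₀, hx₀, -⟩ := hK.exists_lt_of_embedding hH hK.nonempty.some
    obtain ⟨x₁, hx₁, h1⟩ := hK.exists_lt_of_embedding hH (max x₀ (g (t x₀)))
    have h2 := hb x₀ hx₀ x₁ hx₁ ((le_max_left _ _).trans_lt h1).ne
    have h3 : t x₀ = t x₁ := by simpa using h2
    have h4 := ht x₁
    rw [← h3] at h4
    exact (h4.trans ((le_max_right _ _).trans_lt h1)).false

theorem embedding_prod {I J : Type*} (hI : Nonempty (I ↪ K)) (hJ : Nonempty (J ↪ K)) :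
    Nonempty (I × J ↪ K) := by
  obtain ⟨e⟩ := hI
  obtain ⟨e'⟩ := hJ
  obtain ⟨p⟩ : Nonempty (K × K ≃ K) := Cardinal.eq.1 (by
    rw [Cardinal.mk_prod, Cardinal.lift_id, Cardinal.mul_eq_self hK.aleph0_le])
  exact ⟨(e.prodMap e').trans p.toEmbedding⟩

theorem embedding_fin_arrow {I : Type*} (hI : Nonempty (I ↪ K)) (n : ℕ) :
    Nonempty ((Fin n → I) ↪ K) := by
  obtain ⟨e⟩ := hI
  obtain ⟨p⟩ : Nonempty ((Fin n → K) ↪ K) := by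
    rw [← Cardinal.le_def]
    simpa using Cardinal.power_nat_le (n := n) hK.aleph0_le
  exact ⟨(Function.Embedding.arrowCongrRight e).trans p⟩

theorem isEmpty_embedding_Iio (x : K) : IsEmpty (K ↪ Set.Iio x) :=
  ⟨fun e => (hK.small_Iic x).false
    (e.trans (Set.embeddingOfSubset _ _ Set.Iio_subset_Iic_self))⟩

/-! ### Filters from homogeneous sets -/

/-- Along a set that is homogeneous for the comparison of `0`-`1`-sequences in the lexicographic
order, every coordinate is eventually constant. -/
theorem eventually_const_of_homogeneous [WellFoundedLT K] (P : K → K → Prop)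
    (H : Set K)
    (hom : (∀ x ∈ H, ∀ y ∈ H, x < y → ∀ i, (∀ j < i, P j x ↔ P j y) → P i x → P i y) ∨
      ∀ x ∈ H, ∀ y ∈ H, x < y → ∃ i, (∀ j < i, P j x ↔ P j y) ∧ P i x ∧ ¬ P i y) (i : K) :
    ∃ b, ∀ x ∈ H, ∀ y ∈ H, b ≤ x → b ≤ y → (P i x ↔ P i y) := by
  induction i using WellFoundedLT.induction with
  | ind i ih =>
    choose! g hg using ih
    obtain ⟨b, hb⟩ := hK.bounded (hK.isEmpty_embedding_Iio i) fun j => g j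
    have agree : ∀ x ∈ H, ∀ y ∈ H, b ≤ x → b ≤ y → ∀ j < i, P j x ↔ P j y :=
      fun x hx y hy hbx hby j hj =>
        hg j hj x hx y hy ((hb ⟨j, hj⟩).trans hbx) ((hb ⟨j, hj⟩).trans hby)
    -- Beyond `b` the coordinates below `i` no longer change, so the lexicographic comparison forces
    -- coordinate `i` to be monotone. A monotone truth value switches at most once.
    have mono : (∀ x ∈ H, ∀ y ∈ H, b ≤ x → x < y → P i x → P i y) ∨
        ∀ x ∈ H, ∀ y ∈ H, b ≤ x → x < y → P i y → P i x := by
      refine hom.imp (fun h x hx y hy hbx hxy => ?_) fun h x hx y hy hbx hxy hPy => ?_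
      · exact h x hx y hy hxy i (agree x hx y hy hbx (hbx.trans hxy.le))
      · obtain ⟨k, hk, hkx, hky⟩ := h x hx y hy hxy
        rcases lt_trichotomy k i with hki | rfl | hik
        · exact absurd ((agree x hx y hy hbx (hbx.trans hxy.le) k hki).1 hkx) hky
        · exact hkx
        · exact (hk i hik).2 hPy
    have key : ∀ Q : K → Prop, (∀ x ∈ H, ∀ y ∈ H, b ≤ x → x < y → Q x → Q y) →
        ∃ b, ∀ x ∈ H, ∀ y ∈ H, b ≤ x → b ≤ y → (Q x ↔ Q y) := by
      intro Q hQ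
      by_cases hex : ∃ x ∈ H, b ≤ x ∧ Q x
      · obtain ⟨z, hz, hbz, hQz⟩ := hex
        have : ∀ x ∈ H, z ≤ x → Q x := fun x hx hzx =>
          hzx.eq_or_lt.elim (fun h => h ▸ hQz) fun h => hQ z hz x hx hbz h hQz
        exact ⟨z, fun x hx y hy h h' => iff_of_true (this x hx h) (this y hy h')⟩
      · exact ⟨b, fun x hx y hy h h' => iff_of_false (fun hq => hex ⟨x, hx, h, hq⟩)
          fun hq => hex ⟨y, hy, h', hq⟩⟩
    rcases mono with h | h
    · exact key _ h
    · obtain ⟨b', hb'⟩ := key (fun x => ¬ P i x) fun x hx y hy hbx hxy => mt (h x hx y hy hbx hxy)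
      exact ⟨b', fun x hx y hy h h' => not_iff_not.1 (hb' x hx y hy h h')⟩

/-- A filter on `K` that behaves like a uniform complete ultrafilter as far as a given family of
subsets of `K`, indexed by a set that is not larger than `K`, is concerned. -/
theorem exists_filter [WellFoundedLT K] {I : Type*} (hI : Nonempty (I ↪ K)) (P : I → K → Prop) :
    ∃ F : Filter K, F.NeBot ∧ F ≤ atTop ∧
      (∀ {T : Type max v w} (_ : IsEmpty (K ↪ T)) (p : T → K → Prop),
        (∀ t, ∀ᶠ x in F, p t x) → ∀ᶠ x in F, ∀ t, p t x) ∧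
      ∀ i, (∀ᶠ x in F, P i x) ∨ ∀ᶠ x in F, ¬ P i x := by
  classical
  obtain ⟨e⟩ := hI
  have := hK.nonempty
  -- Reindexing by `K` makes the coordinates well-ordered; indices outside the range of `e` get the
  -- empty set.
  let P' : K → K → Prop := fun k x => ∃ i, e i = k ∧ P i x
  have hP' : ∀ i x, P' (e i) x ↔ P i x := fun i x =>
    ⟨fun ⟨j, hj, h⟩ => e.injective hj ▸ h, fun h => ⟨i, rfl, h⟩⟩
  -- `Q x y` says that the sequence of `x` is lexicographically at most that of `y`, with false
  -- below true.
  let Q : K → K → Prop := fun x y => ∀ i, (∀ j < i, P' j x ↔ P' j y) → P' i x → P' i y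
  obtain ⟨H, hH, b, hb⟩ := hK.homogeneous
    (Sym2.lift ⟨fun x y => decide (Q (min x y) (max x y)), fun x y => by
      simp only [min_comm, max_comm]⟩)
  have hb' : ∀ x ∈ H, ∀ y ∈ H, x < y → decide (Q x y) = b := fun x hx y hy hxy => by
    simpa [min_eq_left hxy.le, max_eq_right hxy.le] using hb x hx y hy hxy.ne
  have hconst := hK.eventually_const_of_homogeneous P' H (by
    cases b with
    | true => exact Or.inl fun x hx y hy hxy => of_decide_eq_true (hb' x hx y hy hxy)
    | false =>
      refine Or.inr fun x hx y hy hxy => ?_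
      have := of_decide_eq_false (hb' x hx y hy hxy)
      simp only [Q, not_forall] at this
      obtain ⟨i, h1, h2, h3⟩ := this
      exact ⟨i, h1, h2, h3⟩)
  have ev : ∀ p : K → Prop, (∀ᶠ x in atTop ⊓ 𝓟 H, p x) ↔ ∃ a, ∀ x, a ≤ x → x ∈ H → p x :=
    fun p => by rw [eventually_inf_principal, eventually_atTop]
  refine ⟨atTop ⊓ 𝓟 H, ?_, inf_le_left, ?_, ?_⟩
  · rw [neBot_iff, ne_eq, ← eventually_false_iff_eq_bot, ev]
    rintro ⟨a, ha⟩
    obtain ⟨y, hy, hay⟩ := hK.exists_lt_of_embedding hH a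
    exact ha y hay.le hy
  · intro T hT p hp
    simp only [ev] at hp
    choose g hg using hp
    obtain ⟨a, ha⟩ := hK.bounded hT g
    exact (ev _).2 ⟨a, fun x hx hxH t => hg t x ((ha t).trans hx) hxH⟩
  · intro i
    obtain ⟨a, ha⟩ := hconst (e i)
    obtain ⟨z, hz, haz⟩ := hK.exists_lt_of_embedding hH a
    by_cases h : P' (e i) z
    · exact Or.inl ((ev _).2 ⟨a, fun x hx hxH => (hP' _ _).1 ((ha x hxH z hz hx haz.le).2 h)⟩)
    · exact Or.inr ((ev _).2 ⟨a, fun x hx hxH hP =>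
        h ((ha x hxH z hz hx haz.le).1 ((hP' _ _).2 hP))⟩)

end IsWeaklyCompactOrder

/-! ### Limit operators along a filter -/

open Classical in
/-- For every proper filter there is a (non-additive) `A`-equivariant, normalised retraction of the
group of germs of `A`-valued functions onto the subgroup of constant germs. -/
theorem Filter.exists_equivariant_retraction {K : Type*} (F : Filter K) [F.NeBot] (A : Type*)
    [AddCommGroup A] : ∃ r : (K → A) → A, r 0 = 0 ∧
      ∀ f g a, (∀ᶠ x in F, f x - g x = a) → r f - r g = a := by
  let S : Setoid (K → A) :=
    { r := fun f g => ∃ a, ∀ᶠ x in F, f x - g x = a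
      iseqv := ⟨fun f => ⟨0, by simp⟩,
        fun ⟨a, h⟩ => ⟨-a, h.mono fun x hx => by rw [← hx, neg_sub]⟩,
        fun ⟨a, h⟩ ⟨b, h'⟩ => ⟨a + b, by
          filter_upwards [h, h'] with x hx hx'
          rw [← hx, ← hx', sub_add_sub_cancel]⟩⟩ }
  have hrep : ∀ f : K → A, ∃ a, ∀ᶠ x in F, f x - (Quotient.mk S f).out x = a := fun f =>
    S.symm (Quotient.mk_out f)
  -- `s f` is the constant by which `f` eventually differs from the chosen representative of its
  -- class; subtracting `s 0` below normalises.
  choose s hs using hrep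
  have main : ∀ f g a, (∀ᶠ x in F, f x - g x = a) → s f - s g = a := by
    intro f g a h
    have hfg : Quotient.mk S f = Quotient.mk S g := Quotient.sound ⟨a, h⟩
    have h1 := hs f
    rw [hfg] at h1
    obtain ⟨x, hx, hx1, hx2⟩ := (h.and (h1.and (hs g))).exists
    rw [← hx1, ← hx2, ← hx, sub_sub_sub_cancel_right]
  refine ⟨fun f => s f - s 0, sub_self _, fun f g a h => ?_⟩
  rw [sub_sub_sub_cancel_right, main f g a h]

/-- A limit operator along a filter that behaves like a uniform complete ultrafilter. It preserves
alternating sums of `k` functions taken from a given family when their values are constant. -/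
theorem IsWeaklyCompactOrder.exists_limit {K : Type w} [LinearOrder K] [WellFoundedLT K]
    (hK : IsWeaklyCompactOrder K) {A : Type v} [AddCommGroup A] {k : ℕ}
    (hA : IsEmpty (K ↪ A) ∧ Nonempty (A ↪ K) ∨ k ≤ 2) {I J : Type*} (hI : Nonempty (I ↪ K))
    (hJ : Nonempty (J ↪ K)) (f : I → K → A) (P : J → K → Prop) :
    ∃ (F : Filter K) (r : (K → A) → A), F.NeBot ∧ F ≤ atTop ∧
      (∀ {T : Type max v w} (_ : IsEmpty (K ↪ T)) (p : T → K → Prop),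
        (∀ t, ∀ᶠ x in F, p t x) → ∀ᶠ x in F, ∀ t, p t x) ∧
      (∀ j, (∀ᶠ x in F, P j x) ∨ ∀ᶠ x in F, ¬ P j x) ∧
      (∀ g h : K → A, g =ᶠ[F] h → r g = r h) ∧
      ∀ (c : Fin k → I) (a : A),
        (∀ᶠ x in F, ∑ i : Fin k, (-1 : ℤ) ^ (i : ℕ) • f (c i) x = a) →
          ∑ i : Fin k, (-1 : ℤ) ^ (i : ℕ) • r (f (c i)) = a := by
  classical
  rcases hA with ⟨hA, hA'⟩ | hk
  · have hsum : Nonempty ((I × A) ⊕ J ↪ K) := by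
      obtain ⟨e₁⟩ := hK.embedding_prod hI hA'
      obtain ⟨e₂⟩ := hJ
      obtain ⟨p⟩ : Nonempty (K ⊕ K ≃ K) := Cardinal.eq.1 (by
        rw [Cardinal.mk_sum, Cardinal.lift_id, Cardinal.add_eq_self hK.aleph0_le])
      exact ⟨(e₁.sumMap e₂).trans p.toEmbedding⟩
    obtain ⟨F, hF, hF1, hF2, hF3⟩ := hK.exists_filter.{v, w} hsum
      (Sum.elim (fun ia x => f ia.1 x = ia.2) P)
    -- If no value were the limit, each would be avoided eventually, hence all at once since `A` is
    -- small.
    have hconv : ∀ i, ∃ a, ∀ᶠ x in F, f i x = a := by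
      intro i
      by_contra h
      rw [not_exists] at h
      have h' : ∀ a : ULift.{w} A, ∀ᶠ x in F, f i x ≠ a.down := fun a =>
        (hF3 (Sum.inl (i, a.down))).resolve_left (h a.down)
      obtain ⟨x, hx⟩ := (hF2 ⟨fun e => hA.false (e.trans Equiv.ulift.toEmbedding)⟩ _ h').exists
      exact hx ⟨f i x⟩ rfl
    let r : (K → A) → A := fun g => if h : ∃ a, ∀ᶠ x in F, g x = a then h.choose else 0
    have hr : ∀ g a, (∀ᶠ x in F, g x = a) → r g = a := by
      intro g a h
      have hex : ∃ a, ∀ᶠ x in F, g x = a := ⟨a, h⟩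
      simp only [r, dif_pos hex]
      obtain ⟨x, hx, hx'⟩ := (h.and hex.choose_spec).exists
      rw [← hx, ← hx']
    refine ⟨F, r, hF, hF1, hF2, fun j => hF3 (Sum.inr j), fun g h hgh => ?_, fun c a h => ?_⟩
    · by_cases hex : ∃ a, ∀ᶠ x in F, h x = a
      · obtain ⟨a, ha⟩ := hex
        rw [hr h a ha, hr g a (by filter_upwards [hgh, ha] with x h1 h2; rw [h1, h2])]
      · have hex' : ¬ ∃ a, ∀ᶠ x in F, g x = a := fun ⟨a, ha⟩ =>
          hex ⟨a, by filter_upwards [hgh, ha] with x h1 h2; rw [← h1, h2]⟩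
        simp only [r, dif_neg hex, dif_neg hex']
    · choose l hl using hconv
      have hall : ∀ᶠ x in F, ∀ i, f (c i) x = l (c i) := eventually_all.2 fun i => hl (c i)
      obtain ⟨x, hx, hx'⟩ := (h.and hall).exists
      rw [← hx]
      exact Finset.sum_congr rfl fun i _ => by rw [hr _ _ (hl (c i)), hx' i]
  · obtain ⟨F, hF, hF1, hF2, hF3⟩ := hK.exists_filter.{v, w} hJ P
    obtain ⟨r, hr0, hr⟩ := F.exists_equivariant_retraction A
    refine ⟨F, r, hF, hF1, hF2, hF3, fun g h hgh => sub_eq_zero.1 (hr g h 0 ?_), fun c a h => ?_⟩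
    · exact hgh.mono fun x hx => sub_eq_zero.2 hx
    -- Normalisation handles one term, by comparison with `0`; equivariance handles the difference
    -- of two.
    · interval_cases k
      · obtain ⟨x, hx⟩ := h.exists
        simpa using hx
      · simpa [hr0] using hr (f (c 0)) 0 a (by simpa using h)
      · simpa [Fin.sum_univ_two, ← sub_eq_add_neg] using
          hr (f (c 0)) (f (c 1)) a (by simpa [Fin.sum_univ_two, ← sub_eq_add_neg] using h)

/-! ### Coherent families are trivial -/

namespace OrdinalFamily

variable {δ : Ordinal.{u}} {n : ℕ}

/-- The tuple `(α₀, …, αₙ₋₁, β)`. -/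
def Tuple.snoc (α : Tuple δ n) (β : Set.Iio δ) (h : ∀ i, α i < β) : Tuple δ (n + 1) :=
  OrderEmbedding.ofStrictMono (Fin.snoc (α := fun _ => Set.Iio δ) α β) fun i j hij => by
    induction j using Fin.lastCases with
    | last =>
      induction i using Fin.lastCases with
      | last => exact absurd hij (lt_irrefl _)
      | cast i => simpa using h i
    | cast j =>
      induction i using Fin.lastCases with
      | last => exact absurd (hij.trans (Fin.castSucc_lt_last j)) (lt_irrefl _)
      | cast i => simpa using hij

theorem Tuple.snoc_castSucc (α : Tuple δ n) (β : Set.Iio δ) (h : ∀ i, α i < β) (i : Fin n) :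
    α.snoc β h i.castSucc = α i :=
  Fin.snoc_castSucc (α := fun _ => Set.Iio δ) β α i

theorem Tuple.snoc_last (α : Tuple δ n) (β : Set.Iio δ) (h : ∀ i, α i < β) :
    α.snoc β h (Fin.last n) = β :=
  Fin.snoc_last (α := fun _ => Set.Iio δ) β α

theorem Tuple.face_snoc_last (α : Tuple δ n) (β : Set.Iio δ) (h : ∀ i, α i < β) :
    (α.snoc β h).face (Fin.last n) = α := by
  ext i : 1
  simp [Tuple.face, Tuple.snoc_castSucc]

theorem Tuple.face_snoc_castSucc (α : Tuple δ (n + 1)) (β : Set.Iio δ) (h : ∀ i, α i < β)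
    (j : Fin (n + 1)) :
    (α.snoc β h).face j.castSucc = (α.face j).snoc β fun i => h (j.succAbove i) := by
  ext i : 1
  induction i using Fin.lastCases with
  | last => simp [Tuple.face, Tuple.snoc_last]
  | cast i => simp [Tuple.face, Tuple.snoc_castSucc]

variable {A : Type v} [AddCommGroup A]

open Classical in
/-- Extension of the members of a family by zero. -/
noncomputable def extend (Φ : OrdinalFamily δ n A) (α : Tuple δ n) (ξ : Set.Iio δ) : A :=
  if h : ξ ∈ α.dom then Φ α ⟨ξ, h⟩ else 0

theorem extend_of_mem (Φ : OrdinalFamily δ n A) {α : Tuple δ n} {ξ : Set.Iio δ} (h : ξ ∈ α.dom) :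
    Φ.extend α ξ = Φ α ⟨ξ, h⟩ := dif_pos h

theorem alternatingSum_eq_extend (Φ : OrdinalFamily δ n A) (α : Tuple δ (n + 1)) (ξ : α.dom) :
    Φ.alternatingSum α ξ = ∑ i : Fin (n + 1), (-1 : ℤ) ^ (i : ℕ) • Φ.extend (α.face i) ξ :=
  Finset.sum_congr rfl fun i _ => by rw [extend_of_mem _ (α.dom_subset_face i ξ.2)]

open Classical in
/-- The values `φ_{αβ}(ξ)` as a function of the last coordinate `β`. -/
noncomputable def lastValue (Φ : OrdinalFamily δ (n + 1) A) (p : Tuple δ n × Set.Iio δ)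
    (β : Set.Iio δ) : A :=
  if h : ∀ i, p.1 i < β then Φ.extend (p.1.snoc β h) p.2 else 0

/-- The primitive is the signed limit over the last coordinate. The filter also decides whether the
coherence identity holds exactly at `ξ`, so a point where the primitive fails is a point where the
identity fails for almost all `β`. -/
theorem IsCoherent.isTrivial {κ : Cardinal.{u}} (hκ : IsWeaklyCompactOrder (Set.Iio κ.ord))
    (hA : IsEmpty (Set.Iio κ.ord ↪ A) ∧ Nonempty (A ↪ Set.Iio κ.ord) ∨ n + 1 ≤ 2)
    {Φ : OrdinalFamily κ.ord (n + 1) A} (hΦ : Φ.IsCoherent) : Φ.IsTrivial := by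
  have := hκ.noMaxOrder
  have := hκ.nonempty
  have hT : ∀ m, Nonempty (Tuple κ.ord m × Set.Iio κ.ord ↪ Set.Iio κ.ord) := fun m => by
    obtain ⟨e⟩ := hκ.embedding_fin_arrow ⟨Function.Embedding.refl _⟩ m
    exact hκ.embedding_prod ⟨Function.Embedding.trans
      ⟨fun α : Tuple κ.ord m => (α : Fin m → Set.Iio κ.ord), DFunLike.coe_injective⟩ e⟩ ⟨Function.Embedding.refl _⟩
  obtain ⟨F, r, hF, hF1, hF2, hF3, -, hr⟩ := hκ.exists_limit hA (hT n) (hT (n + 1)) Φ.lastValue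
    fun p β => ∑ i : Fin (n + 1), (-1 : ℤ) ^ (i : ℕ) • Φ.lastValue (p.1.face i, p.2) β =
      (-1 : ℤ) ^ n • Φ.extend p.1 p.2
  -- The face deleting `β` carries the sign `(-1)^(n+1)`; moving it across the equation leaves
  -- `(-1)^n`.
  refine ⟨fun α ξ => (-1 : ℤ) ^ n • r (Φ.lastValue (α, ξ)), fun α => ?_⟩
  by_contra hinf
  let x := Set.Infinite.natEmbedding _ hinf
  have hbad : ∀ k : ULift.{max v (u + 1)} ℕ, ∀ᶠ β in F,
      ¬ ∑ i : Fin (n + 1), (-1 : ℤ) ^ (i : ℕ) • Φ.lastValue (α.face i, (x k.down).1.1) β =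
        (-1 : ℤ) ^ n • Φ.extend α (x k.down).1.1 := by
    rintro ⟨k⟩
    refine (hF3 (α, (x k).1.1)).resolve_left fun h => (x k).2 ?_
    have h1 := hr (fun i => (α.face i, (x k).1.1)) _ h
    have h2 : (-1 : ℤ) ^ n * (-1) ^ n = 1 := by rw [← mul_pow]; simp
    change ∑ i : Fin (n + 1), (-1 : ℤ) ^ (i : ℕ) •
      ((-1 : ℤ) ^ n • r (Φ.lastValue (α.face i, (x k).1.1))) = _
    simp_rw [smul_comm _ ((-1 : ℤ) ^ n)]
    rw [← Finset.smul_sum, h1, smul_smul, h2, one_smul, extend_of_mem _ (x k).1.2]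
  have hbad' := hF2 ⟨fun e => hκ.uncountable.false (e.trans Equiv.ulift.toEmbedding)⟩ _ hbad
  obtain ⟨β, hβ, hlt⟩ := (hbad'.and (eventually_all.2 fun i => hF1 (eventually_gt_atTop (α i)))).exists
  have hdom : ∀ ξ ∈ α.dom, ξ ∈ (α.snoc β hlt).dom := fun ξ hξ i => by
    induction i using Fin.lastCases with
    | last => rw [Tuple.snoc_last]; exact (hξ 0).trans (hlt 0)
    | cast i => rw [Tuple.snoc_castSucc]; exact hξ i
  -- For this one `β`, all the points `x k` lie in the support that coherence makes finite.
  refine Set.infinite_of_injective_forall_mem (f := fun k : ℕ =>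
    (⟨(x k).1.1, hdom _ (x k).1.2⟩ : (α.snoc β hlt).dom)) (fun k l hkl => ?_) (fun k => ?_)
    (hΦ (α.snoc β hlt))
  · simp only [Subtype.mk.injEq] at hkl
    exact x.injective (Subtype.ext (Subtype.ext hkl))
  · intro h0
    refine hβ ⟨k⟩ ?_
    rw [alternatingSum_eq_extend, Fin.sum_univ_castSucc] at h0
    simp only [Tuple.face_snoc_last, Tuple.face_snoc_castSucc, Fin.val_castSucc, Fin.val_last] at h0
    have hval : ∀ i, Φ.lastValue (α.face i, (x k).1.1) β =
        Φ.extend ((α.face i).snoc β fun j => hlt (i.succAbove j)) (x k).1.1 := fun i =>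
      dif_pos fun j => hlt (i.succAbove j)
    simp_rw [hval]
    rw [eq_neg_of_add_eq_zero_left h0, pow_succ]
    simp

end OrdinalFamily

/-! ### The order topology of a well-order -/

section WellOrder

variable {K : Type u} [LinearOrder K] [WellFoundedLT K] [NoMaxOrder K] [TopologicalSpace K]
  [OrderTopology K]

theorem isOpen_Iic_of_wellFoundedLT (x : K) : IsOpen (Set.Iic x) := by
  have h : Set.Iic x = Set.Iio (wellFounded_lt.min (Set.Ioi x) (exists_gt x)) := by
    ext y
    refine ⟨fun hy => lt_of_le_of_lt hy (wellFounded_lt.min_mem (Set.Ioi x) _), fun hy => ?_⟩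
    by_contra hxy
    exact wellFounded_lt.not_lt_min (Set.Ioi x) (not_le.1 hxy) hy
  rw [h]
  exact isOpen_Iio

/-- The half-open interval `(x, y]` of a well-order, as an open set. -/
def openIoc (x y : K) : Opens K :=
  ⟨Set.Ioc x y, by
    rw [← Set.Ioi_inter_Iic]
    exact isOpen_Ioi.inter (isOpen_Iic_of_wellFoundedLT y)⟩

theorem mem_openIoc {x y z : K} : z ∈ openIoc x y ↔ x < z ∧ z ≤ y := Iff.rfl

/-- A point of a well-order has arbitrarily small neighbourhoods indexed by the points below it. -/
theorem eventually_nhds_iff_of_wellFoundedLT {x : K} {p : K → Prop} :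
    (∀ᶠ z in nhds x, p z) ↔ p x ∧ ((∃ y, y < x) → ∃ y < x, ∀ z, y < z → z ≤ x → p z) := by
  refine ⟨fun h => ⟨h.self_of_nhds, fun hx => ?_⟩, fun ⟨h, h'⟩ => ?_⟩
  · obtain ⟨y, hy, hsub⟩ := exists_Ioc_subset_of_mem_nhds h hx
    exact ⟨y, hy, fun z h1 h2 => hsub ⟨h1, h2⟩⟩
  · by_cases hx : ∃ y, y < x
    · obtain ⟨y, hy, hp⟩ := h' hx
      exact ((openIoc y x).isOpen.eventually_mem ⟨hy, le_rfl⟩).mono fun z hz => hp z hz.1 hz.2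
    · refine ((isOpen_Iic_of_wellFoundedLT x).eventually_mem (Set.mem_Iic.2 le_rfl)).mono fun z hz => ?_
      rwa [le_antisymm hz (not_lt.1 fun hzx => hx ⟨z, hzx⟩)]

end WellOrder

/-! ### Refinements of open covers -/

namespace Cech

theorem OpenCover.exists_mem {X : Type u} [TopologicalSpace X] (V : OpenCover X) (x : X) :
    ∃ v ∈ V.sets, x ∈ v := by
  have : x ∈ sSup V.sets := V.sSup_eq ▸ trivial
  exact Opens.mem_sSup.1 this

section Covers

variable {K : Type u} [LinearOrder K] [WellFoundedLT K] [NoMaxOrder K] [TopologicalSpace K]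
  [OrderTopology K] (V : OpenCover K)

/-- Every initial segment has a partition into open sets that refines a given cover. -/
theorem OpenCover.exists_partition_Iic (ξ : K) : ∃ p : K → Opens K, ∀ x ≤ ξ, x ∈ p x ∧
    (∃ v ∈ V.sets, p x ≤ v) ∧ ∀ z ∈ p x, z ≤ ξ ∧ p z = p x := by
  induction ξ using WellFoundedLT.induction with
  | ind ξ ih =>
    obtain ⟨v, hv, hξ⟩ := V.exists_mem ξ
    by_cases hbot : ∃ y, y < ξ
    · obtain ⟨y, hy, hsub⟩ := exists_Ioc_subset_of_mem_nhds (v.isOpen.mem_nhds hξ) hbot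
      -- The interval `(y, ξ]` is a single block; the induction hypothesis partitions the rest.
      obtain ⟨p, hp⟩ := ih y hy
      classical
      refine ⟨fun x => if x ≤ y then p x else openIoc y ξ, fun x hx => ?_⟩
      by_cases hxy : x ≤ y
      · obtain ⟨h1, h2, h3⟩ := hp x hxy
        simp only [if_pos hxy]
        exact ⟨h1, h2, fun z hz => ⟨(h3 z hz).1.trans hy.le, by rw [if_pos (h3 z hz).1, (h3 z hz).2]⟩⟩
      · simp only [if_neg hxy]
        exact ⟨⟨not_le.1 hxy, hx⟩, ⟨v, hv, hsub⟩, fun z hz => ⟨hz.2, if_neg (not_le.2 hz.1)⟩⟩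
    · have hmin : ∀ z ≤ ξ, z = ξ := fun z hz =>
        le_antisymm hz (not_lt.1 fun hzx => hbot ⟨z, hzx⟩)
      refine ⟨fun _ => ⟨Set.Iic ξ, isOpen_Iic_of_wellFoundedLT ξ⟩, fun x hx =>
        ⟨hx, ⟨v, hv, fun z hz => hmin z hz ▸ hξ⟩, fun z hz => ⟨hz, rfl⟩⟩⟩

/-- If countable sets are bounded, then every open cover contains, up to refinement, all the
intervals `(η, β]` for some `η`. -/
theorem OpenCover.exists_openIoc_le [Nonempty K] (hb : ∀ g : ℕ → K, BddAbove (Set.range g)) :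
    ∃ η, ∀ β, ∃ v ∈ V.sets, openIoc η β ≤ v := by
  by_contra! h
  choose s hs using h
  have hlt : ∀ η, η < s η := fun η => by
    by_contra hle
    obtain ⟨v, hv, -⟩ := V.exists_mem η
    exact hs η v hv fun z hz => absurd (hz.1.trans_le hz.2) hle
  -- At the supremum `x` of these iterates, a cover member contains some `(y, x]`, hence some `(a k,
  -- a (k + 1)]`, against the choice of `s`.
  let a : ℕ → K := fun k => s^[k] (Classical.arbitrary K)
  have hsucc : ∀ k, a (k + 1) = s (a k) := fun k => Function.iterate_succ_apply' _ _ _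
  obtain ⟨x, hx, hmin⟩ : ∃ x, (∀ k, a k ≤ x) ∧ ∀ y < x, ∃ k, y < a k := by
    obtain ⟨b, hb⟩ := hb a
    have hne : {x | ∀ k, a k ≤ x}.Nonempty := ⟨b, fun k => hb ⟨k, rfl⟩⟩
    refine ⟨wellFounded_lt.min _ hne, wellFounded_lt.min_mem _ hne, fun y hy => ?_⟩
    by_contra! hya
    exact wellFounded_lt.not_lt_min {x | ∀ k, a k ≤ x} hya hy
  obtain ⟨v, hv, hxv⟩ := V.exists_mem x
  have hax : a 0 < x := (hlt _).trans_le ((hsucc 0).symm.trans_le (hx 1))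
  obtain ⟨y, hy, hsub⟩ := exists_Ioc_subset_of_mem_nhds (v.isOpen.mem_nhds hxv) ⟨_, hax⟩
  obtain ⟨k, hk⟩ := hmin y hy
  exact hs (a k) v hv fun z hz => hsub ⟨hk.trans hz.1, hz.2.trans ((hsucc k).symm.trans_le (hx _))⟩

/-- Every open cover has a small refinement `W` with members `q β x` that contain `x` for large
`β` and that depend on `x` in a locally constant way. -/
theorem OpenCover.exists_refinement [Nonempty K] (hb : ∀ g : ℕ → K, BddAbove (Set.range g)) :
    ∃ W : OpenCover K, V ≤ W ∧ (∃ e : K ⊕ K → W.sets, Function.Surjective e) ∧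
      ∃ q : K → K → W.sets, ∀ x, ∀ᶠ β in atTop, x ∈ W.family (q β x) ∧
        ∀ᶠ z in nhds x, q β z = q β x := by
  classical
  obtain ⟨η, hη⟩ := V.exists_openIoc_le hb
  obtain ⟨p, hp⟩ := V.exists_partition_Iic η
  let Q : K → K → Opens K := fun β x => if x ≤ η then p x else openIoc η β
  -- The default `openIoc η η` is empty, so it does no harm to the refinement.
  let e : K ⊕ K → Opens K := Sum.elim (fun x => if x ≤ η then p x else openIoc η η) (openIoc η)
  have hQ : ∀ β x, Q β x ∈ Set.range e := fun β x => by
    by_cases hx : x ≤ η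
    · exact ⟨Sum.inl x, by simp [e, Q, hx]⟩
    · exact ⟨Sum.inr β, by simp [e, Q, hx]⟩
  have hmem : ∀ x β, x ≤ β → x ∈ Q β x := fun x β hβ => by
    by_cases hx : x ≤ η
    · simpa [Q, hx] using (hp x hx).1
    · simpa [Q, hx] using mem_openIoc.2 ⟨not_le.1 hx, hβ⟩
  let W : OpenCover K := ⟨Set.range e, top_le_iff.1 fun x _ =>
    Opens.mem_sSup.2 ⟨Q x x, hQ x x, hmem x x le_rfl⟩⟩
  refine ⟨W, ?_, ⟨Set.rangeFactorization e, Set.rangeFactorization_surjective⟩,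
    fun β x => ⟨Q β x, hQ β x⟩, fun x => ?_⟩
  · rintro _ ⟨y | β, rfl⟩
    · by_cases hy : y ≤ η
      · simpa [e, hy] using (hp y hy).2.1
      · simpa [e, hy] using hη η
    · exact hη β
  · refine (eventually_ge_atTop x).mono fun β hβ => ⟨hmem x β hβ, ?_⟩
    refine ((Q β x).isOpen.eventually_mem (hmem x β hβ)).mono fun z hz => Subtype.ext ?_
    change Q β z = Q β x
    by_cases hx : x ≤ η
    · have hz' : z ∈ p x := by simpa [Q, hx] using hz
      obtain ⟨h1, h2⟩ := (hp x hx).2.2 z hz'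
      simp [Q, hx, h1, h2]
    · have hz' : z ∈ openIoc η β := by simpa [Q, hx] using hz
      simp [Q, hx, hz'.1]

end Covers

/-! ### Cocycles are coboundaries -/

section Cochains

variable {X : Type u} [TopologicalSpace X] {A : Type v} [AddCommGroup A] {ι : Type w}
  {U : ι → Opens X} {n : ℕ}

open Classical in
/-- Extension of the members of a cochain by zero. -/
noncomputable def Cochain.extend (c : Cochain A U n) (s : Fin (n + 1) → ι) (x : X) : A :=
  if h : x ∈ inter U s then c s ⟨x, h⟩ else 0

theorem Cochain.extend_of_mem (c : Cochain A U n) {s : Fin (n + 1) → ι} {x : X}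
    (h : x ∈ inter U s) : c.extend s x = c s ⟨x, h⟩ := dif_pos h

theorem mem_inter_succAbove {s : Fin (n + 1) → ι} {x : X} (h : x ∈ inter U s) (i : Fin (n + 1)) :
    x ∈ inter U (s ∘ i.succAbove) := fun j => h (i.succAbove j)

theorem isOpen_inter (s : Fin n → ι) : IsOpen (inter U s) := by
  have : inter U s = ⋂ i, (U (s i) : Set X) := by
    ext x
    simp [inter]
  rw [this]
  exact isOpen_iInter_of_finite fun i => (U (s i)).isOpen

theorem Cochain.eventually_extend_eq (c : Cochain A U n) {s : Fin (n + 1) → ι} {x : X}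
    (h : x ∈ inter U s) : ∀ᶠ z in nhds x, c.extend s z = c.extend s x := by
  have h1 := (IsLocallyConstant.iff_eventually_eq _).1 (c s).isLocallyConstant ⟨x, h⟩
  rw [nhds_subtype_eq_comap, eventually_comap] at h1
  filter_upwards [h1, (isOpen_inter s).eventually_mem h] with z hz hzs
  rw [c.extend_of_mem hzs, c.extend_of_mem h]
  exact hz ⟨z, hzs⟩ rfl

theorem d_apply (c : Cochain A U n) (s : Fin (n + 2) → ι) (x : X) (h : x ∈ inter U s) :
    d A U n c s ⟨x, h⟩ =
      ∑ i : Fin (n + 2), (-1 : ℤ) ^ (i : ℕ) • c.extend (s ∘ i.succAbove) x := by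
  change (∑ i : Fin (n + 2), (-1 : ℤ) ^ (i : ℕ) • res A _ (c (s ∘ i.succAbove)) :
    LocallyConstant (inter U s) A) ⟨x, h⟩ = _
  have happ : ∀ g : Fin (n + 2) → LocallyConstant (inter U s) A,
      (∑ i, g i) ⟨x, h⟩ = ∑ i, g i ⟨x, h⟩ := fun g =>
    map_sum (LocallyConstant.evalAddMonoidHom (⟨x, h⟩ : inter U s)) g _
  rw [happ]
  refine Finset.sum_congr rfl fun i _ => ?_
  rw [c.extend_of_mem (mem_inter_succAbove h i)]
  rfl

theorem snoc_comp_castSucc_succAbove (s : Fin (n + 1) → ι) (w : ι) (i : Fin (n + 1)) :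
    (Fin.snoc s w : Fin (n + 2) → ι) ∘ i.castSucc.succAbove = Fin.snoc (s ∘ i.succAbove) w := by
  funext j
  induction j using Fin.lastCases with
  | last => simp
  | cast j => simp

theorem mem_inter_snoc {s : Fin n → ι} {w : ι} {x : X} :
    x ∈ inter U (Fin.snoc s w : Fin (n + 1) → ι) ↔ x ∈ inter U s ∧ x ∈ U w := by
  refine ⟨fun h => ⟨fun i => by simpa using h i.castSucc, by simpa using h (Fin.last n)⟩,
    fun h i => ?_⟩
  induction i using Fin.lastCases with
  | last => simpa using h.2
  | cast i => simpa using h.1 i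

/-- This is the cocycle identity at `(s, w)`, solved for the face that deletes `w`. -/
theorem sum_extend_snoc_of_mem_cocycles {c : Cochain A U n} (hc : c ∈ cocycles A U n)
    {s : Fin (n + 1) → ι} {w : ι} {x : X} (hs : x ∈ inter U s) (hw : x ∈ U w) :
    ∑ i : Fin (n + 1), (-1 : ℤ) ^ (i : ℕ) • c.extend (Fin.snoc (s ∘ i.succAbove) w) x =
      (-1 : ℤ) ^ n • c.extend s x := by
  have h0 : d A U n c = 0 := hc
  have h := d_apply c (Fin.snoc s w) x (mem_inter_snoc.2 ⟨hs, hw⟩)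
  have hlast : (Fin.snoc s w : Fin (n + 2) → ι) ∘ (Fin.last (n + 1)).succAbove = s := by
    funext j
    simp
  rw [h0, Fin.sum_univ_castSucc, hlast] at h
  simp only [snoc_comp_castSucc_succAbove, Fin.val_castSucc, Fin.val_last] at h
  have h' := eq_neg_of_add_eq_zero_left h.symm
  rw [h', pow_succ]
  simp

end Cochains

/-- The primitive is again a signed limit, now of `c` at `(s, q β x)`. The main point is local
constancy: the neighbourhood of `x` on which the integrand is constant varies with `β`. -/
theorem mem_coboundaries_of_mem_cocycles {K : Type u} [LinearOrder K] [WellFoundedLT K]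
    [TopologicalSpace K] [OrderTopology K] (hK : IsWeaklyCompactOrder K) {A : Type v}
    [AddCommGroup A] {n : ℕ}
    (hA : IsEmpty (K ↪ A) ∧ Nonempty (A ↪ K) ∨ n + 2 ≤ 2) {ι : Type w} (hι : Nonempty (ι ↪ K))
    {U : ι → Opens K} {q : K → K → ι}
    (hq : ∀ x, ∀ᶠ β in atTop, x ∈ U (q β x) ∧ ∀ᶠ z in nhds x, q β z = q β x)
    {c : Cochain A U (n + 1)} (hc : c ∈ cocycles A U (n + 1)) :
    c ∈ coboundaries A U (n + 1) := by
  have := hK.noMaxOrder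
  have hidK : Nonempty (K ↪ K) := ⟨Function.Embedding.refl K⟩
  have hI := hK.embedding_prod (hK.embedding_fin_arrow hι (n + 1)) hidK
  let f : (Fin (n + 1) → ι) × K → K → A := fun p β => c.extend (Fin.snoc p.1 (q β p.2)) p.2
  obtain ⟨F, r, hF, hF1, hF2, hF3, hr, hsum⟩ := hK.exists_limit hA hI (hK.embedding_prod hI hidK) f
    fun p β => f (p.1.1, p.2) β = f p.1 β
  have hloc : ∀ (s : Fin (n + 1) → ι), ∀ x ∈ inter U s,
      ∀ᶠ z in nhds x, r (f (s, z)) = r (f (s, x)) := by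
    intro s x hx
    have hnhds : ∀ᶠ β in F, ∀ᶠ z in nhds x, f (s, z) β = f (s, x) β := by
      filter_upwards [hF1 (hq x)] with β hβ
      filter_upwards [hβ.2, c.eventually_extend_eq (mem_inter_snoc.2 ⟨hx, hβ.1⟩)] with z h1 h2
      simpa only [f, h1] using h2
    refine eventually_nhds_iff_of_wellFoundedLT.2 ⟨rfl, fun hbot => ?_⟩
    -- There are fewer than `κ` left endpoints below `x`, so by completeness one serves frequently
    -- many `β`. As the filter decides each equality, frequently becomes eventually.
    obtain ⟨y, hy, hfreq⟩ : ∃ y < x, ∃ᶠ β in F, ∀ z, y < z → z ≤ x → f (s, z) β = f (s, x) β := by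
      by_contra! h
      have h' : ∀ y : ULift.{v} (Set.Iio x), ∀ᶠ β in F,
          ¬ ∀ z, y.down.1 < z → z ≤ x → f (s, z) β = f (s, x) β := fun y =>
        not_frequently.1 (by simpa using h y.down.1 y.down.2)
      have hall := hF2 ⟨fun e => (hK.isEmpty_embedding_Iio x).false
        (e.trans Equiv.ulift.toEmbedding)⟩ _ h'
      obtain ⟨β, h1, h2⟩ := (hall.and hnhds).exists
      obtain ⟨y, hy, h3⟩ := (eventually_nhds_iff_of_wellFoundedLT.1 h2).2 hbot
      exact h1 ⟨y, hy⟩ h3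
    refine ⟨y, hy, fun z hyz hzx => hr _ _ ?_⟩
    refine (hF3 ((s, x), z)).resolve_right fun h => ?_
    obtain ⟨β, h1, h2⟩ := (hfreq.and_eventually h).exists
    exact h2 (h1 z hyz hzx)
  let b : Cochain A U n := fun s =>
    ⟨fun x => (-1 : ℤ) ^ (n + 1) • r (f (s, x)), (IsLocallyConstant.iff_eventually_eq _).2 fun x => by
      have h := continuous_subtype_val.continuousAt.eventually (hloc s x.1 x.2)
      exact h.mono fun z hz => by rw [hz]⟩
  refine ⟨b, funext fun s => LocallyConstant.ext fun ⟨x, hx⟩ => ?_⟩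
  rw [d_apply b s x hx]
  have hb : ∀ i : Fin (n + 2), b.extend (s ∘ i.succAbove) x =
      (-1 : ℤ) ^ (n + 1) • r (f (s ∘ i.succAbove, x)) := fun i =>
    b.extend_of_mem (mem_inter_succAbove hx i)
  have h1 := hsum (fun i => (s ∘ i.succAbove, x)) ((-1 : ℤ) ^ (n + 1) • c.extend s x) (by
    filter_upwards [hF1 (hq x)] with β hβ
    have h := sum_extend_snoc_of_mem_cocycles hc hx hβ.1
    simpa only [f] using h)
  have h2 : (-1 : ℤ) ^ (n + 1) * (-1) ^ (n + 1) = 1 := by rw [← mul_pow]; simp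
  simp_rw [hb, smul_comm _ ((-1 : ℤ) ^ (n + 1))]
  rw [← Finset.smul_sum, h1, smul_smul, h2, one_smul, c.extend_of_mem hx]

/-- The Čech cohomology groups vanish if every cover has a refinement whose cohomology does. -/
theorem subsingleton_cohomology {X : Type u} [TopologicalSpace X] {A : Type v} [AddCommGroup A]
    {n : ℕ} (h : ∀ V : OpenCover X, ∃ W, V ≤ W ∧
      cocycles A W.family n ≤ coboundaries A W.family n) : Subsingleton (Cohomology X A n) := by
  classical
  -- Each class already dies in the cohomology of a refinement, so the identity vanishes on every
  -- stage of the limit.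
  have key : AddMonoidHom.id (Cohomology X A n) = 0 := by
    refine AddCommGroup.DirectLimit.hom_ext _ fun V => AddMonoidHom.ext fun x => ?_
    obtain ⟨W, hVW, hW⟩ := h V
    have : Subsingleton (CoverCohomology A W.family n) := by
      rw [CoverCohomology, AddSubgroup.addSubgroupOf_eq_top.2 hW]
      exact QuotientAddGroup.subsingleton_quotient_top
    refine (AddCommGroup.DirectLimit.of_f
      (G := fun V : OpenCover X => CoverCohomology A V.family n)
      (f := fun _ _ h => coverCohomologyMap A (OpenCover.refine h) (OpenCover.le_refine h) n)
      hVW x).symm.trans ?_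
    rw [Subsingleton.elim (coverCohomologyMap A _ _ n x) 0, map_zero]
    rfl
  exact ⟨fun x y => by rw [← AddMonoidHom.id_apply _ x, ← AddMonoidHom.id_apply _ y, key]; rfl⟩

end Cech

theorem mainTheorem5 (κ : Cardinal.{u}) (hκ : IsWeaklyCompact κ) (n : ℕ) (hn : 1 ≤ n)
    (A : Type u) [AddCommGroup A] (hA : Cardinal.mk A < κ ∨ n = 1) :
    (∀ Φ : OrdinalFamily κ.ord n A, Φ.IsCoherent → Φ.IsTrivial) ∧
      Subsingleton (Cech.Cohomology (Set.Iio κ.ord) A n) := by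
  have hK := hκ.isWeaklyCompactOrder
  obtain ⟨m, rfl⟩ : ∃ m, n = m + 1 := ⟨n - 1, by omega⟩
  have hA' : IsEmpty (Set.Iio κ.ord ↪ A) ∧ Nonempty (A ↪ Set.Iio κ.ord) ∨ m + 2 ≤ 2 := by
    refine hA.imp (fun h => ?_) fun h => by omega
    rw [← not_nonempty_iff, ← Cardinal.lift_mk_le', ← Cardinal.lift_mk_le',
      Cardinal.mk_Iio_ordinal, Cardinal.card_ord]
    simpa using ⟨h, h.le⟩
  refine ⟨fun Φ hΦ => hΦ.isTrivial hK (hA'.imp_right (by omega)),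
    Cech.subsingleton_cohomology fun V => ?_⟩
  have := hK.noMaxOrder
  have := hK.nonempty
  have hb : ∀ g : ℕ → Set.Iio κ.ord, BddAbove (Set.range g) := fun g =>
    (hK.bounded hK.uncountable g).imp fun b hb => by
      rintro _ ⟨k, rfl⟩
      exact hb k
  obtain ⟨W, hVW, ⟨e, he⟩, q, hq⟩ := V.exists_refinement hb
  obtain ⟨p⟩ : Nonempty (Set.Iio κ.ord ⊕ Set.Iio κ.ord ≃ Set.Iio κ.ord) := Cardinal.eq.1 (by
    rw [Cardinal.mk_sum, Cardinal.lift_id, Cardinal.add_eq_self hK.aleph0_le])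
  exact ⟨W, hVW, fun c hc => Cech.mem_coboundaries_of_mem_cocycles hK hA'
    ⟨(Function.Embedding.ofSurjective e he).trans p.toEmbedding⟩ hq hc⟩
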